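/- All graphs are finite and simple. A planar triangulation is a connected graph that has an embedding in the plane in which every face (including the outer one) is bounded by a triangle. Embeddings are described combinatorially, by a rotation system: for each vertex, a cyclic order of the edges at it. The faces are the closed walks obtained by always leaving a vertex along the edge that follows, in the cyclic order there, the edge just used to enter it, and the embedding is in the plane when $|V|-|E|+|F|=2$. An edge-coloring is proper if any two distinct edges sharing an endpoint receive different colors, and a subgraph is rainbow if its edges have pairwise distinct colors. A graph is $k$-connected if it has more than $k$ vertices and remains connected after the deletion of any set of fewer than $k$ vertices. **Theorem 1.2.** Let $G$ be a planar triangulation on at least five vertices such that $G$ has a proper edge-coloring containing no rainbow copy of the $4$-cycle $C_4$ (as a not necessarily induced subgraph). Then $G$ has minimum degree exactly $5$ and $G$ is $4$-connected. -/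

import Mathlib

namespace SimpleGraph

/-- A rotation system on a simple graph: a permutation of the darts (oriented edges) which, for
every vertex `v`, permutes the darts starting at `v` in one single cycle. It records the cyclic
order in which the edges leave each vertex of a graph drawn on an oriented surface, and is the
standard combinatorial description of a (cellular) embedding of a connected graph. -/
structure RotationSystem {V : Type*} (G : SimpleGraph V) where
  /-- The next dart around the same starting vertex. -/
  next : Equiv.Perm G.Dart
  fst_next : ∀ d : G.Dart, (next d).fst = d.fst
  sameCycle_next : ∀ d d' : G.Dart, d.fst = d'.fst → next.SameCycle d d'

namespace RotationSystem

variable {V : Type*} {G : SimpleGraph V}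

/-- The next dart along the boundary of a face: after traversing the edge `u → v`, turn around at
`v` and leave along the edge that follows `v → u` in the cyclic order at `v`. -/
def faceNext (R : RotationSystem G) : Equiv.Perm G.Dart :=
  (Function.Involutive.toPerm Dart.symm Dart.symm_involutive).trans R.next

/-- The faces of the embedding, each one given by its boundary walk: the orbits of `faceNext`. -/
def Face (R : RotationSystem G) : Type _ :=
  Quotient (Equiv.Perm.SameCycle.setoid R.faceNext)

/-- The embedding of a (finite connected) graph described by a rotation system is an embedding in
the plane, equivalently the sphere: the Euler characteristic `|V| - |E| + |F|` of the surface
obtained by gluing a disc to each boundary walk is `2`. -/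
def IsPlane (R : RotationSystem G) : Prop :=
  Nat.card V + Nat.card R.Face = Nat.card G.edgeSet + 2

/-- Every face is bounded by a triangle: every boundary walk closes up after three steps.
(In a simple graph no closed walk has length one, so the walk has exactly three darts
`u → v → w → u`, and its vertices are distinct.) -/
def AllFacesTriangles (R : RotationSystem G) : Prop :=
  ∀ d : G.Dart, R.faceNext (R.faceNext (R.faceNext d)) = d

end RotationSystem

/-- A planar triangulation: a connected graph with an embedding in the plane in which every face,
the outer one included, is bounded by a triangle. (A finite such graph has `3 |V| - 6` edges by
Euler's formula, so it is automatically edge-maximal among the planar graphs on `V`.) -/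
def IsPlanarTriangulation {V : Type*} (G : SimpleGraph V) : Prop :=
  G.Connected ∧ ∃ R : RotationSystem G, R.IsPlane ∧ R.AllFacesTriangles

/-- The edge-coloring `c` of `G` contains a rainbow copy of `H`: a (not necessarily induced)
subgraph of `G` isomorphic to `H` whose edges have pairwise distinct colors. Proper
edge-colorings are the proper vertex colorings of the line graph. -/
def HasRainbowCopy {V W C : Type*} {G : SimpleGraph V} (c : G.lineGraph.Coloring C)
    (H : SimpleGraph W) : Prop :=
  ∃ f : Copy H G, Function.Injective fun e : H.edgeSet => c (f.mapEdgeSet e)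

/-- `G` is `k`-connected: it has more than `k` vertices, and deleting fewer than `k` vertices
always leaves a connected graph. -/
def IsVertexConnected {V : Type*} [Fintype V] (G : SimpleGraph V) (k : ℕ) : Prop :=
  k < Fintype.card V ∧
    ∀ S : Finset V, S.card < k → (G.induce {v | v ∉ S}).Connected

end SimpleGraph

/-! Without a rainbow `C₄`, every 4-cycle has two opposite edges of one color. Two local
obstructions follow: the wheel with four spokes (`hasRainbowCopy_of_wheel`) and a triangle two of
whose edges each have two further common neighbors (`hasRainbowCopy_of_triangle`). The second makes
every triangle facial: each edge of a non-facial triangle lies on two faces whose third vertices are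
off the triangle.

Degrees at most 2 are impossible in a triangulation this large. Degree 3 would make the link a
non-facial triangle, and degree 4 would give a wheel, so all degrees are at least 5. Euler's
formula, the only use of planarity, supplies a vertex of degree at most 5.

For 4-connectivity, every vertex of a minimal separator has two neighbors in it. A separator of
order at most three is thus a triangle with both sides meeting every corner, which cannot be a face.
-/

namespace SimpleGraph

/-! ### Local obstructions for the coloring -/

section Coloring

variable {V C : Type*} {G : SimpleGraph V}

open Classical in
/-- The color of the edge `uv`, and `none` if `u` and `v` are not adjacent. -/
noncomputable def edgeColor (c : G.lineGraph.Coloring C) (u v : V) : Option C :=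
  if h : G.Adj u v then some (c ⟨s(u, v), h⟩) else none

theorem edgeColor_comm (c : G.lineGraph.Coloring C) (u v : V) :
    edgeColor c u v = edgeColor c v u := by
  unfold edgeColor
  by_cases h : G.Adj u v
  · rw [dif_pos h, dif_pos h.symm]
    congr 3
    exact Sym2.eq_swap
  · rw [dif_neg h, dif_neg fun h' => h h'.symm]

theorem edgeColor_ne (c : G.lineGraph.Coloring C) {x y z : V} (hy : G.Adj x y) (hz : G.Adj x z)
    (hyz : y ≠ z) : edgeColor c x y ≠ edgeColor c x z := by
  rw [edgeColor, edgeColor, dif_pos hy, dif_pos hz]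
  intro h
  refine c.valid (v := ⟨s(x, y), hy⟩) (w := ⟨s(x, z), hz⟩) ?_ (Option.some.inj h)
  rw [lineGraph_adj_iff_exists]
  refine ⟨?_, x, by simp, by simp⟩
  intro h
  have := congrArg Subtype.val h
  simp only [Sym2.eq_iff] at this
  grind

/-- In a proper edge-coloring without rainbow `C₄`, every 4-cycle has two opposite edges of the
same color. -/
theorem edgeColor_opposite (c : G.lineGraph.Coloring C) (hc : ¬ HasRainbowCopy c (cycleGraph 4))
    {x y z w : V} (hxy : G.Adj x y) (hyz : G.Adj y z) (hzw : G.Adj z w) (hwx : G.Adj w x)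
    (hxz : x ≠ z) (hyw : y ≠ w) :
    edgeColor c x y = edgeColor c z w ∨ edgeColor c y z = edgeColor c w x := by
  by_contra! hne
  obtain ⟨h1, h2⟩ := hne
  apply hc
  let g : Fin 4 → V := ![x, y, z, w]
  have hg : Function.Injective g := by
    have := hxy.ne; have := hyz.ne; have := hzw.ne; have := hwx.ne
    intro i j
    fin_cases i <;> fin_cases j <;> simp [g] <;> grind
  have hsucc : ∀ i, G.Adj (g i) (g (i + 1)) := by
    intro i
    fin_cases i <;> assumption
  have heq : ∀ {i j}, (cycleGraph 4).Adj i j → i = j + 1 ∨ j = i + 1 := by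
    intro i j h
    rw [cycleGraph_adj] at h
    exact h.imp (fun h => by rw [← h, add_sub_cancel]) (fun h => by rw [← h, add_sub_cancel])
  have hadj : ∀ {i j}, (cycleGraph 4).Adj i j → G.Adj (g i) (g j) := by
    intro i j h
    rcases heq h with rfl | rfl
    exacts [(hsucc j).symm, hsucc i]
  let f : Copy (cycleGraph 4) G := ⟨⟨g, hadj⟩, hg⟩
  have hcol : ∀ i j (h : (cycleGraph 4).Adj i j),
      some (c (f.mapEdgeSet ⟨s(i, j), h⟩)) = edgeColor c (g i) (g j) := by
    intro i j h
    rw [edgeColor, dif_pos (hadj h)]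
    rfl
  have hcyc : ∀ e : (cycleGraph 4).edgeSet, ∃ i : Fin 4, ∃ h : (cycleGraph 4).Adj i (i + 1),
      e = ⟨s(i, i + 1), h⟩ := by
    rintro ⟨e, he⟩
    induction e using Sym2.ind with
    | _ i j =>
      have he' : (cycleGraph 4).Adj i j := he
      rcases heq he' with rfl | rfl
      · exact ⟨j, he'.symm, Subtype.ext Sym2.eq_swap⟩
      · exact ⟨i, he', rfl⟩
  refine ⟨f, ?_⟩
  intro e e' hee
  obtain ⟨i, hi, rfl⟩ := hcyc e
  obtain ⟨j, hj, rfl⟩ := hcyc e'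
  have hee' := congrArg some hee
  simp only [hcol] at hee'
  have a1 := edgeColor_ne c hxy hwx.symm hyw
  have a2 := edgeColor_ne c hyz hxy.symm hxz.symm
  have a3 := edgeColor_ne c hzw hyz.symm hyw.symm
  have a4 := edgeColor_ne c hwx hzw.symm hxz
  have b1 := edgeColor_comm c x y
  have b2 := edgeColor_comm c y z
  have b3 := edgeColor_comm c z w
  have b4 := edgeColor_comm c w x
  -- Distinct edges of the 4-cycle either share a vertex, where properness applies (`a1` to `a4`),
  -- or are opposite, where `h1` and `h2` apply.
  have hij : i = j := by
    clear hee hi hj hcol hcyc f hadj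
    fin_cases i <;> fin_cases j <;> first | rfl | (exfalso; simp [g] at hee'; grind)
  subst hij
  rfl

/-- Among three common neighbors `z, p, q` of the ends of an edge `xy`, some one of `p, q` is
joined to `x` in the color of `yz`, and to `y` in a color not used on the triangle `xyz`. -/
theorem exists_common_neighbor_edgeColor_eq (c : G.lineGraph.Coloring C)
    (hc : ¬ HasRainbowCopy c (cycleGraph 4)) {x y z p q : V} (hxy : G.Adj x y)
    (hxz : G.Adj x z) (hyz : G.Adj y z) (hxp : G.Adj x p) (hyp : G.Adj y p) (hxq : G.Adj x q)
    (hyq : G.Adj y q) (hzp : z ≠ p) (hzq : z ≠ q) (hpq : p ≠ q) :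
    ∃ r, G.Adj x r ∧ G.Adj y r ∧ r ≠ z ∧ edgeColor c x r = edgeColor c y z ∧
      edgeColor c y r ≠ edgeColor c x z ∧ edgeColor c y r ≠ edgeColor c x y := by
  have h1 := edgeColor_opposite c hc hxz hyz.symm hyp hxp.symm hxy.ne hzp
  have h2 := edgeColor_opposite c hc hxz hyz.symm hyq hxq.symm hxy.ne hzq
  have h3 := edgeColor_opposite c hc hxp hyp.symm hyq hxq.symm hxy.ne hpq
  rw [edgeColor_comm c z y, edgeColor_comm c p x] at h1
  rw [edgeColor_comm c z y, edgeColor_comm c q x] at h2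
  rw [edgeColor_comm c p y, edgeColor_comm c q x] at h3
  have a1 := edgeColor_ne c hxz hxp hzp
  have a2 := edgeColor_ne c hxz hxq hzq
  have a3 := edgeColor_ne c hxp hxq hpq
  have b1 := edgeColor_ne c hyz hyp hzp
  have b2 := edgeColor_ne c hyz hyq hzq
  have b3 := edgeColor_ne c hyp hyq hpq
  have d1 := edgeColor_ne c hxy.symm hyp hxp.ne
  have d2 := edgeColor_ne c hxy.symm hyq hxq.ne
  rw [edgeColor_comm c y x] at d1 d2
  -- By properness at `x` and `y`, exactly one of `p`, `q` repeats the color of `yz` at `x`, and the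
  -- other repeats the color of `xz` at `y`.
  by_cases hp : edgeColor c x p = edgeColor c y z
  · exact ⟨p, hxp, hyp, hzp.symm, hp, by grind, d1.symm⟩
  · exact ⟨q, hxq, hyq, hzq.symm, by grind, by grind, d2.symm⟩

/-- If two edges of a triangle have two further common neighbors each, then every proper
edge-coloring has a rainbow `C₄`. -/
theorem hasRainbowCopy_of_triangle (c : G.lineGraph.Coloring C) {x y z p q p' q' : V}
    (hxy : G.Adj x y) (hxz : G.Adj x z) (hyz : G.Adj y z)
    (hxp : G.Adj x p) (hyp : G.Adj y p) (hxq : G.Adj x q) (hyq : G.Adj y q)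
    (hzp : z ≠ p) (hzq : z ≠ q) (hpq : p ≠ q)
    (hxp' : G.Adj x p') (hzp' : G.Adj z p') (hxq' : G.Adj x q') (hzq' : G.Adj z q')
    (hyp' : y ≠ p') (hyq' : y ≠ q') (hpq' : p' ≠ q') :
    HasRainbowCopy c (cycleGraph 4) := by
  by_contra hc
  obtain ⟨r, hxr, hyr, -, e1, e2, e3⟩ := exists_common_neighbor_edgeColor_eq c hc hxy hxz hyz
    hxp hyp hxq hyq hzp hzq hpq
  obtain ⟨r', hxr', hzr', -, e1', e2', e3'⟩ := exists_common_neighbor_edgeColor_eq c hc hxz hxy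
    hyz.symm hxp' hzp' hxq' hzq' hyp' hyq' hpq'
  -- Both `xr` and `xr'` have the color of `yz`. Once they coincide, the cycle `x y r z` violates
  -- the opposite-edge condition.
  obtain rfl : r = r' := by
    by_contra hne
    exact edgeColor_ne c hxr hxr' hne (by rw [e1, e1', edgeColor_comm])
  have h := edgeColor_opposite c hc hxy hyr hzr'.symm hxz.symm hxr.ne hyz.ne
  rw [edgeColor_comm c r z, edgeColor_comm c z x] at h
  exact h.elim (fun h => e2' h.symm) e2

/-- Every proper edge-coloring of the wheel with four spokes has a rainbow `C₄`. -/
theorem hasRainbowCopy_of_wheel (c : G.lineGraph.Coloring C) {v x y z w : V}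
    (hx : G.Adj v x) (hy : G.Adj v y) (hz : G.Adj v z) (hw : G.Adj v w)
    (hxy : G.Adj x y) (hyz : G.Adj y z) (hzw : G.Adj z w) (hwx : G.Adj w x)
    (hxz : x ≠ z) (hyw : y ≠ w) : HasRainbowCopy c (cycleGraph 4) := by
  by_contra hc
  have h0 := edgeColor_opposite c hc hxy hyz hzw hwx hxz hyw
  have h1 := edgeColor_opposite c hc hx hxy hyz hz.symm hy.ne hxz
  have h2 := edgeColor_opposite c hc hy hyz hzw hw.symm hz.ne hyw
  have h3 := edgeColor_opposite c hc hz hzw hwx hx.symm hw.ne hxz.symm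
  have h4 := edgeColor_opposite c hc hw hwx hxy hy.symm hx.ne hyw.symm
  rw [edgeColor_comm c z v] at h1
  rw [edgeColor_comm c w v] at h2
  rw [edgeColor_comm c x v] at h3
  rw [edgeColor_comm c y v] at h4
  have a1 := edgeColor_ne c hx hy hxy.ne
  have a2 := edgeColor_ne c hx hz hxz
  have a3 := edgeColor_ne c hx hw hwx.ne.symm
  have a4 := edgeColor_ne c hy hz hyz.ne
  have a5 := edgeColor_ne c hy hw hyw
  have a6 := edgeColor_ne c hz hw hzw.ne
  -- The four cycles through the hub propagate: fixing which alternative holds in `h1` forces the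
  -- others cyclically, so the rim repeats the four distinct spoke colors, contradicting `h0`.
  grind

end Coloring

/-! ### Rotation systems and facial triangles -/

namespace RotationSystem

variable {V : Type*} {G : SimpleGraph V} {R : RotationSystem G}

/-- The edge `xz` follows the edge `xy` in the cyclic order at `x`. -/
def Follows (R : RotationSystem G) (x y z : V) : Prop :=
  ∃ (hy : G.Adj x y) (hz : G.Adj x z), R.next ⟨(x, y), hy⟩ = ⟨(x, z), hz⟩

theorem follows_of_next_eq {d d' : G.Dart} (h : R.next d = d') :
    R.Follows d.fst d.snd d'.snd := by
  have hf : d'.fst = d.fst := h ▸ R.fst_next d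
  refine ⟨d.adj, hf ▸ d'.adj, ?_⟩
  refine h.trans ?_
  ext
  · exact hf
  · rfl

theorem exists_follows (R : RotationSystem G) {x y : V} (h : G.Adj x y) :
    ∃ z, R.Follows x y z :=
  ⟨_, R.follows_of_next_eq (d := ⟨(x, y), h⟩) rfl⟩

theorem exists_followed (R : RotationSystem G) {x z : V} (h : G.Adj x z) :
    ∃ y, R.Follows x y z := by
  have hf : (R.next.symm ⟨(x, z), h⟩).fst = x := by
    rw [← R.fst_next, Equiv.apply_symm_apply]
  have := R.follows_of_next_eq (Equiv.apply_symm_apply R.next ⟨(x, z), h⟩)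
  rw [hf] at this
  exact ⟨_, this⟩

theorem Follows.unique_right {x y z z' : V} (h : R.Follows x y z) (h' : R.Follows x y z') :
    z = z' := by
  obtain ⟨_, _, e⟩ := h
  obtain ⟨_, _, e'⟩ := h'
  exact congrArg (fun d : G.Dart => d.snd) (e.symm.trans e')

theorem Follows.unique_left {x y y' z : V} (h : R.Follows x y z) (h' : R.Follows x y' z) :
    y = y' := by
  obtain ⟨_, _, e⟩ := h
  obtain ⟨_, _, e'⟩ := h'
  exact congrArg (fun d : G.Dart => d.snd) (R.next.injective (e.trans e'.symm))

theorem Follows.adj_left {x y z : V} (h : R.Follows x y z) : G.Adj x y := h.1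

theorem Follows.adj_right {x y z : V} (h : R.Follows x y z) : G.Adj x z := h.2.1

theorem Follows.rotate (hR : R.AllFacesTriangles) {x y z : V} (h : R.Follows x y z) :
    R.Follows z x y := by
  obtain ⟨hy, hz, e⟩ := h
  have h0 := hR ⟨(y, x), hy.symm⟩
  have h1 : R.faceNext ⟨(y, x), hy.symm⟩ = ⟨(x, z), hz⟩ := e
  rw [h1] at h0
  have h2 : R.faceNext ⟨(x, z), hz⟩ = R.next ⟨(z, x), hz.symm⟩ := rfl
  rw [h2] at h0
  have h3 := R.follows_of_next_eq (d := ⟨(z, x), hz.symm⟩) rfl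
  -- The third step of the face walk returns to the dart from `y` to `x`, so the second dart must
  -- end at `y`.
  have h4 := R.fst_next (R.next ⟨(z, x), hz.symm⟩).symm
  have h5 : (R.next (R.next ⟨(z, x), hz.symm⟩).symm).fst = y :=
    congrArg (fun d : G.Dart => d.fst) h0
  have h6 : (R.next ⟨(z, x), hz.symm⟩).snd = y := h4.symm.trans h5
  rw [h6] at h3
  exact h3

theorem Follows.adj (hR : R.AllFacesTriangles) {x y z : V} (h : R.Follows x y z) : G.Adj y z :=
  (h.rotate hR).adj_right.symm

/-- Induction around a vertex: the darts at `x` form a single cycle of `next`, so forward steps from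
`y` reach all neighbors. -/
theorem forall_adj_of_follows [Finite V] (R : RotationSystem G) {x y : V} (h : G.Adj x y)
    {P : V → Prop} (hP : P y) (hstep : ∀ a b, R.Follows x a b → P a → P b) {z : V}
    (hz : G.Adj x z) : P z := by
  classical
  have : Fintype V := Fintype.ofFinite V
  obtain ⟨n, hn⟩ := (R.sameCycle_next ⟨(x, y), h⟩ ⟨(x, z), hz⟩ rfl).exists_nat_pow_eq
  have key : ∀ n : ℕ, ((R.next ^ n) ⟨(x, y), h⟩).fst = x ∧ P ((R.next ^ n) ⟨(x, y), h⟩).snd := by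
    intro n
    induction n with
    | zero => exact ⟨rfl, hP⟩
    | succ n ih =>
      rw [pow_succ', Equiv.Perm.mul_apply]
      refine ⟨(R.fst_next _).trans ih.1, ?_⟩
      refine hstep _ _ ?_ ih.2
      have := R.follows_of_next_eq (d := (R.next ^ n) ⟨(x, y), h⟩) rfl
      rwa [ih.1] at this
  have := (key n).2
  rwa [hn] at this

/-- Turning around `x` from a neighbor in `A` to one outside `A`, one leaves `A`. -/
theorem exists_follows_mem_notMem [Finite V] (R : RotationSystem G) {x y z : V} {A : Set V}
    (hy : G.Adj x y) (hyA : y ∈ A) (hz : G.Adj x z) (hzA : z ∉ A) :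
    ∃ a b, R.Follows x a b ∧ a ∈ A ∧ b ∉ A := by
  by_contra! h
  exact hzA (R.forall_adj_of_follows hy (P := (· ∈ A)) hyA h hz)

end RotationSystem

theorem Connected.forall_mem_of_adj {V : Type*} {G : SimpleGraph V} (hG : G.Connected) {S : Set V}
    {x : V} (hx : x ∈ S) (h : ∀ a ∈ S, ∀ b, G.Adj a b → b ∈ S) (y : V) : y ∈ S := by
  obtain ⟨w⟩ := hG.preconnected x y
  induction w with
  | nil => exact hx
  | cons hadj _ ih => exact ih (h _ hx _ hadj)

/-! ### Small degrees and non-facial triangles -/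

namespace RotationSystem

variable {V : Type*} {G : SimpleGraph V} {R : RotationSystem G}

/-- If both orientations of a triangle were faces, each corner would have degree two, and by
connectedness the triangle would be the whole graph. -/
theorem Follows.not_swap [Fintype V] (hR : R.AllFacesTriangles) (hG : G.Connected)
    (hV : 5 ≤ Fintype.card V) {x y z : V} (h : R.Follows x y z) : ¬ R.Follows x z y := by
  classical
  intro h'
  have key : ∀ {a b c : V}, R.Follows a b c → R.Follows a c b → ∀ d, G.Adj a d → d = b ∨ d = c := by
    intro a b c h h' d hd
    refine R.forall_adj_of_follows h.adj_left (P := fun d => d = b ∨ d = c) (Or.inl rfl) ?_ hd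
    rintro e f hef (rfl | rfl)
    · exact Or.inr (hef.unique_right h)
    · exact Or.inl (hef.unique_right h')
  have hall : ∀ v, v ∈ (({x, y, z} : Finset V) : Set V) := by
    refine hG.forall_mem_of_adj (x := x) (by simp) ?_
    intro a ha b hab
    simp only [Finset.coe_insert, Finset.coe_singleton, Set.mem_insert_iff,
      Set.mem_singleton_iff] at ha ⊢
    rcases ha with rfl | rfl | rfl
    · have := key h h' b hab; tauto
    · have := key ((h.rotate hR).rotate hR) (h'.rotate hR) b hab; tauto
    · have := key (h.rotate hR) ((h'.rotate hR).rotate hR) b hab; tauto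
  have h3 : Fintype.card V ≤ ({x, y, z} : Finset V).card :=
    Finset.card_le_card fun v _ => hall v
  have := Finset.card_le_three (a := x) (b := y) (c := z)
  omega

/-- A vertex of degree three lies in the triangle formed by its neighbors, and this triangle
is not a face. -/
theorem Follows.not_facial_link [Fintype V] (hR : R.AllFacesTriangles) (hG : G.Connected)
    (hV : 5 ≤ Fintype.card V) {x y z w : V} (h1 : R.Follows x y z) (h2 : R.Follows x z w)
    (h3 : R.Follows x w y) : ¬ R.Follows y z w ∧ ¬ R.Follows y w z := by
  classical
  have key : ∀ {a b c d : V}, R.Follows a b c → R.Follows a c d → R.Follows a d b →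
      ∀ e, G.Adj a e → e = b ∨ e = c ∨ e = d := by
    intro a b c d h h' h'' e he
    refine R.forall_adj_of_follows h.adj_left (P := fun e => e = b ∨ e = c ∨ e = d)
      (Or.inl rfl) ?_ he
    rintro f g hfg (rfl | rfl | rfl)
    · exact Or.inr (Or.inl (hfg.unique_right h))
    · exact Or.inr (Or.inr (hfg.unique_right h'))
    · exact Or.inl (hfg.unique_right h'')
  constructor
  · intro h
    exact h2.adj_right.ne (((h1.rotate hR).rotate hR).unique_right h)
  · intro h
    have hall : ∀ v, v ∈ (({x, y, z, w} : Finset V) : Set V) := by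
      refine hG.forall_mem_of_adj (x := x) (by simp) ?_
      intro a ha b hab
      simp only [Finset.coe_insert, Finset.coe_singleton, Set.mem_insert_iff,
        Set.mem_singleton_iff] at ha ⊢
      rcases ha with rfl | rfl | rfl | rfl
      · have := key h1 h2 h3 b hab; tauto
      · have := key ((h1.rotate hR).rotate hR) (h3.rotate hR) h b hab; tauto
      · have := key ((h2.rotate hR).rotate hR) (h1.rotate hR) (h.rotate hR) b hab; tauto
      · have := key ((h3.rotate hR).rotate hR) (h2.rotate hR) ((h.rotate hR).rotate hR) b hab
        tauto
    have h4 : Fintype.card V ≤ ({x, y, z, w} : Finset V).card :=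
      Finset.card_le_card fun v _ => hall v
    have := Finset.card_le_four (a := x) (b := y) (c := z) (d := w)
    omega

/-- In a triangulation with a proper edge-coloring without rainbow `C₄`, every triangle is a
face. -/
theorem follows_or_follows_of_triangle [Fintype V] (hR : R.AllFacesTriangles) (hG : G.Connected)
    (hV : 5 ≤ Fintype.card V) {C : Type*} {c : G.lineGraph.Coloring C}
    (hc : ¬ HasRainbowCopy c (cycleGraph 4)) {x y z : V} (hxy : G.Adj x y) (hxz : G.Adj x z)
    (hyz : G.Adj y z) : R.Follows x y z ∨ R.Follows x z y := by
  by_contra! hn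
  obtain ⟨n1, n2⟩ := hn
  obtain ⟨p, hp⟩ := R.exists_follows hxy
  obtain ⟨q, hq⟩ := R.exists_followed hxy
  obtain ⟨p', hp'⟩ := R.exists_follows hxz
  obtain ⟨q', hq'⟩ := R.exists_followed hxz
  refine hc (hasRainbowCopy_of_triangle c hxy hxz hyz hp.adj_right (hp.adj hR) hq.adj_left
    (hq.adj hR).symm ?_ ?_ ?_ hp'.adj_right (hp'.adj hR) hq'.adj_left (hq'.adj hR).symm ?_ ?_ ?_)
  · rintro rfl; exact n1 hp
  · rintro rfl; exact n2 hq
  · rintro rfl; exact hp.not_swap hR hG hV hq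
  · rintro rfl; exact n2 hp'
  · rintro rfl; exact n1 hq'
  · rintro rfl; exact hp'.not_swap hR hG hV hq'

/-- Five successive neighbors around `v` are distinct: a return after two, three or four steps is
excluded by `not_swap`, by the facial link of a degree-three vertex, and by the wheel, respectively.
-/
theorem five_le_degree [Fintype V] [DecidableRel G.Adj] (hR : R.AllFacesTriangles)
    (hG : G.Connected) (hV : 5 ≤ Fintype.card V) {C : Type*} {c : G.lineGraph.Coloring C}
    (hc : ¬ HasRainbowCopy c (cycleGraph 4)) (v : V) : 5 ≤ G.degree v := by
  classical
  have : Nontrivial V := Fintype.one_lt_card_iff_nontrivial.mp (by omega)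
  obtain ⟨y₀, h₀⟩ := hG.preconnected.exists_adj_of_nontrivial v
  obtain ⟨y₁, h₁⟩ := R.exists_follows h₀
  obtain ⟨y₂, h₂⟩ := R.exists_follows h₁.adj_right
  obtain ⟨y₃, h₃⟩ := R.exists_follows h₂.adj_right
  obtain ⟨y₄, h₄⟩ := R.exists_follows h₃.adj_right
  have two : ∀ {a b d : V}, R.Follows v a b → R.Follows v b d → a ≠ d := by
    rintro a b d h h' rfl
    exact h.not_swap hR hG hV h'
  have three : ∀ {a b d e : V}, R.Follows v a b → R.Follows v b d → R.Follows v d e → a ≠ e := by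
    rintro a b d e h h' h'' rfl
    obtain ⟨k1, k2⟩ := h.not_facial_link hR hG hV h' h''
    rcases R.follows_or_follows_of_triangle hR hG hV hc (h.adj hR) (h''.adj hR).symm
      (h'.adj hR) with k | k
    exacts [k1 k, k2 k]
  have four : y₀ ≠ y₄ := by
    rintro rfl
    exact hc (hasRainbowCopy_of_wheel c h₀ h₁.adj_right h₂.adj_right h₃.adj_right (h₁.adj hR)
      (h₂.adj hR) (h₃.adj hR) (h₄.adj hR) (two h₁ h₂) (two h₂ h₃))
  have n01 := (h₁.adj hR).ne
  have n12 := (h₂.adj hR).ne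
  have n23 := (h₃.adj hR).ne
  have n34 := (h₄.adj hR).ne
  have n02 := two h₁ h₂
  have n13 := two h₂ h₃
  have n24 := two h₃ h₄
  have n03 := three h₁ h₂ h₃
  have n14 := three h₂ h₃ h₄
  have hcard : ({y₀, y₁, y₂, y₃, y₄} : Finset V).card = 5 := by
    simp [Finset.card_insert_of_notMem, *]
  rw [← hcard, ← card_neighborFinset_eq_degree]
  apply Finset.card_le_card
  intro u hu
  rw [mem_neighborFinset]
  simp only [Finset.mem_insert, Finset.mem_singleton] at hu
  rcases hu with rfl | rfl | rfl | rfl | rfl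
  exacts [h₀, h₁.adj_right, h₂.adj_right, h₃.adj_right, h₄.adj_right]

/-! ### Euler's formula -/

theorem faceNext_ne (R : RotationSystem G) (d : G.Dart) : R.faceNext d ≠ d := by
  intro h
  have h1 : (R.faceNext d).fst = d.snd := R.fst_next d.symm
  rw [h] at h1
  exact d.adj.ne h1

/-- If all faces are triangles, there are at most as many faces as thirds of darts. -/
theorem three_mul_card_face_le [Fintype V] [DecidableRel G.Adj] (hR : R.AllFacesTriangles) :
    3 * Nat.card R.Face ≤ Fintype.card G.Dart := by
  classical
  have : Fintype R.Face := Quotient.fintype _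
  rw [Nat.card_eq_fintype_card]
  let π : G.Dart → R.Face := Quotient.mk _
  have hfib : ∀ f ∈ (Finset.univ : Finset R.Face),
      3 ≤ (Finset.univ.filter fun d : G.Dart => π d = f).card := by
    intro f _
    obtain ⟨d, rfl⟩ := Quotient.exists_rep f
    have hstep : ∀ d, π (R.faceNext d) = π d := fun d =>
      Quotient.sound (Equiv.Perm.sameCycle_apply_left.mpr (Equiv.Perm.SameCycle.refl _ _))
    have n1 := R.faceNext_ne d
    have n2 := R.faceNext_ne (R.faceNext d)
    have n3 := R.faceNext_ne (R.faceNext (R.faceNext d))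
    rw [hR d] at n3
    have hcard : ({d, R.faceNext d, R.faceNext (R.faceNext d)} : Finset G.Dart).card = 3 :=
      Finset.card_eq_three.mpr ⟨_, _, _, n1.symm, n3, n2.symm, rfl⟩
    rw [← hcard]
    apply Finset.card_le_card
    intro e he
    simp only [Finset.mem_insert, Finset.mem_singleton] at he
    rw [Finset.mem_filter]
    refine ⟨Finset.mem_univ _, ?_⟩
    rcases he with rfl | rfl | rfl
    · rfl
    · exact hstep d
    · exact (hstep _).trans (hstep d)
  have := Finset.card_nsmul_le_sum Finset.univ
    (fun f : R.Face => (Finset.univ.filter fun d : G.Dart => π d = f).card) 3 hfib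
  rw [← Finset.card_eq_sum_card_fiberwise (fun d _ => Finset.mem_coe.mpr (Finset.mem_univ (π d)))] at this
  simp only [Finset.card_univ, smul_eq_mul] at this
  omega

theorem exists_degree_le_five [Fintype V] [DecidableRel G.Adj] (hR : R.AllFacesTriangles)
    (hP : R.IsPlane) : ∃ v, G.degree v ≤ 5 := by
  classical
  by_contra! h
  have h1 := R.three_mul_card_face_le hR
  have h2 : Nat.card G.edgeSet = G.edgeFinset.card := by
    rw [Nat.card_eq_fintype_card, edgeFinset_card]
  have h3 := G.sum_degrees_eq_twice_card_edges
  have h4 := Finset.card_nsmul_le_sum Finset.univ (fun v => G.degree v) 6 fun v _ => h v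
  have h5 := G.dart_card_eq_twice_card_edges
  have h6 := hP
  unfold IsPlane at h6
  rw [h2, Nat.card_eq_fintype_card (α := V)] at h6
  rw [Finset.card_univ, smul_eq_mul] at h4
  -- If all degrees were at least 6, then `3|V| ≤ |E|` and `3|F| ≤ 2|E|`, so `3(|V| + |F|) ≤ 3|E|`,
  -- against Euler's formula.
  omega

/-! ### Separators -/

/-- A triangulation in which all triangles are faces has no separation of order at most three. -/
theorem not_separation [Finite V] (hR : R.AllFacesTriangles) (hG : G.Connected)
    (htri : ∀ x y z, G.Adj x y → G.Adj x z → G.Adj y z → R.Follows x y z ∨ R.Follows x z y)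
    (S : Finset V) (hS : S.card < 4) (A B : Set V) (hcover : ∀ v, v ∈ A ∨ v ∈ S ∨ v ∈ B)
    (hAS : ∀ v ∈ A, v ∉ S) (hBS : ∀ v ∈ B, v ∉ S) (hAB : ∀ v ∈ A, v ∉ B)
    (hadj : ∀ a ∈ A, ∀ b ∈ B, ¬ G.Adj a b) (hA : A.Nonempty) (hB : B.Nonempty) : False := by
  classical
  induction hn : S.card generalizing S A B with
  | zero =>
    rw [Finset.card_eq_zero] at hn
    subst hn
    obtain ⟨a, ha⟩ := hA
    obtain ⟨b, hb⟩ := hB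
    refine hAB b (hG.forall_mem_of_adj ha ?_ b) hb
    intro u hu w huw
    rcases hcover w with h | h | h
    · exact h
    · simp at h
    · exact absurd huw (hadj u hu w h)
  | succ n ih =>
    -- A separator vertex with no neighbor in `A` could be moved into `B`, leaving a smaller
    -- separator. Stated for arbitrary sides so that it applies with `A` and `B` exchanged.
    have shift : ∀ (A B : Set V), (∀ v, v ∈ A ∨ v ∈ S ∨ v ∈ B) → (∀ v ∈ A, v ∉ S) →
        (∀ v ∈ B, v ∉ S) → (∀ v ∈ A, v ∉ B) → (∀ a ∈ A, ∀ b ∈ B, ¬ G.Adj a b) → A.Nonempty →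
        B.Nonempty → ∀ v ∈ S, ∃ a ∈ A, G.Adj v a := by
      intro A B hcover hAS hBS hAB hadj hA hB v hv
      by_contra! hno
      have hcard := Finset.card_erase_of_mem hv
      refine ih (S.erase v) (by omega) A (insert v B) ?_ ?_ ?_ ?_ ?_ hA (Set.insert_nonempty _ _)
        (by omega)
      · intro u
        rw [Finset.mem_erase, Set.mem_insert_iff]
        have := hcover u
        tauto
      · exact fun u hu h => hAS u hu (Finset.mem_of_mem_erase h)
      · rintro u (rfl | hu) h
        · simp at h
        · exact hBS u hu (Finset.mem_of_mem_erase h)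
      · rintro u hu (rfl | h)
        · exact hAS u hu hv
        · exact hAB u hu h
      · rintro a ha b (rfl | hb) hab
        · exact hno a ha hab.symm
        · exact hadj a ha b hb hab
    have hnbA := shift A B hcover hAS hBS hAB hadj hA hB
    have hnbB := shift B A (fun v => by have := hcover v; tauto) hBS hAS
      (fun v hv h => hAB v h hv) (fun b hb a ha h => hadj a ha b hb h.symm) hB hA
    -- Successive neighbors of `v` are adjacent, so the rotation cannot pass directly between `A`
    -- and `B`; it leaves either side into `S`.
    have turn : ∀ v ∈ S, ∃ a s b t, R.Follows v a s ∧ R.Follows v b t ∧ a ∈ A ∧ b ∈ B ∧ s ∈ S ∧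
        t ∈ S := by
      intro v hv
      obtain ⟨a, ha, hva⟩ := hnbA v hv
      obtain ⟨b, hb, hvb⟩ := hnbB v hv
      obtain ⟨a', s, has, ha', hs⟩ := R.exists_follows_mem_notMem hva ha hvb fun h => hAB b h hb
      obtain ⟨b', t, hbt, hb', ht⟩ := R.exists_follows_mem_notMem hvb hb hva (hAB a ha)
      refine ⟨a', s, b', t, has, hbt, ha', hb', ?_, ?_⟩
      · have := hcover s
        have : s ∉ B := fun h => hadj a' ha' s h (has.adj hR)
        tauto
      · have := hcover t
        have : t ∉ A := fun h => hadj t h b' hb' (hbt.adj hR).symm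
        tauto
    obtain ⟨v, hv⟩ : S.Nonempty := Finset.card_pos.mp (by omega)
    obtain ⟨a, s, b, t, has, hbt, ha, hb, hs, ht⟩ := turn v hv
    have hst : s ≠ t := by
      rintro rfl
      exact hAB a ha (has.unique_left hbt ▸ hb)
    have hvs := has.adj_right
    have hvt := hbt.adj_right
    have hSeq : S = {v, s, t} := by
      symm
      apply Finset.eq_of_subset_of_card_le
      · intro u hu
        simp only [Finset.mem_insert, Finset.mem_singleton] at hu
        rcases hu with rfl | rfl | rfl <;> assumption
      · rw [Finset.card_eq_three.mpr ⟨v, s, t, hvs.ne, hvt.ne, hst, rfl⟩]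
        omega
    -- The vertex `s` also has two distinct neighbors in `S = {v, s, t}`, so `t` is one of them.
    have hadj_st : G.Adj s t := by
      obtain ⟨a', s', b', t', has', hbt', ha', hb', hs', ht'⟩ := turn s hs
      have hst' : s' ≠ t' := by
        rintro rfl
        exact hAB a' ha' (has'.unique_left hbt' ▸ hb')
      rw [hSeq] at hs' ht'
      simp only [Finset.mem_insert, Finset.mem_singleton] at hs' ht'
      have e1 := has'.adj_right
      have e2 := hbt'.adj_right
      have := e1.ne
      have := e2.ne
      grind
    -- If the triangle is a face, then at `v` one of `s`, `t` immediately precedes the other, but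
    -- their predecessors are `a ∈ A` and `b ∈ B`.
    rcases htri v s t hvs hvt hadj_st with h | h
    · exact hBS b hb (h.unique_left hbt ▸ hs)
    · exact hAS a ha (h.unique_left has ▸ ht)

end RotationSystem

/-- A set of vertices whose deletion leaves a nonempty disconnected graph yields a separation. -/
theorem exists_separation_of_not_connected_induce {V : Type*} {G : SimpleGraph V} (S : Finset V)
    {x : V} (hx : x ∉ S) (h : ¬ (G.induce {v | v ∉ S}).Connected) :
    ∃ A B : Set V, (∀ v, v ∈ A ∨ v ∈ S ∨ v ∈ B) ∧ (∀ v ∈ A, v ∉ S) ∧ (∀ v ∈ B, v ∉ S) ∧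
      (∀ v ∈ A, v ∉ B) ∧ (∀ a ∈ A, ∀ b ∈ B, ¬ G.Adj a b) ∧ A.Nonempty ∧ B.Nonempty := by
  have : Nonempty {v | v ∉ S} := ⟨⟨x, hx⟩⟩
  have hp : ¬ (G.induce {v | v ∉ S}).Preconnected := fun hp => h ⟨hp⟩
  unfold Preconnected at hp
  push Not at hp
  obtain ⟨u, w, huw⟩ := hp
  refine ⟨{v | ∃ hv : v ∉ S, (G.induce {v | v ∉ S}).Reachable u ⟨v, hv⟩},
    {v | ∃ hv : v ∉ S, ¬ (G.induce {v | v ∉ S}).Reachable u ⟨v, hv⟩}, ?_, ?_, ?_, ?_, ?_,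
    ⟨u, u.2, Reachable.refl _⟩, ⟨w, w.2, huw⟩⟩
  · intro v
    by_cases hv : v ∈ S
    · exact Or.inr (Or.inl hv)
    · by_cases hr : (G.induce {v | v ∉ S}).Reachable u ⟨v, hv⟩
      · exact Or.inl ⟨hv, hr⟩
      · exact Or.inr (Or.inr ⟨hv, hr⟩)
  · exact fun v hv => hv.1
  · exact fun v hv => hv.1
  · rintro v ⟨_, hr⟩ ⟨_, hr'⟩
    exact hr' hr
  · rintro a ⟨ha, hr⟩ b ⟨hb, hr'⟩ hab
    refine hr' (hr.trans (Adj.reachable ?_))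
    exact hab

end SimpleGraph

theorem theorem1p2 {V C : Type*} [Fintype V] (G : SimpleGraph V) [DecidableRel G.Adj]
    (hV : 5 ≤ Fintype.card V) (hG : G.IsPlanarTriangulation)
    (c : G.lineGraph.Coloring C)
    (hc : ¬ SimpleGraph.HasRainbowCopy c (SimpleGraph.cycleGraph 4)) :
    G.minDegree = 5 ∧ G.IsVertexConnected 4 := by
  obtain ⟨hconn, R, hplane, hR⟩ := hG
  have : Nonempty V := hconn.nonempty
  refine ⟨le_antisymm ?_ ?_, by omega, ?_⟩
  · obtain ⟨v, hv⟩ := R.exists_degree_le_five hR hplane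
    exact (G.minDegree_le_degree v).trans hv
  · exact G.le_minDegree_of_forall_le_degree 5 (R.five_le_degree hR hconn hV hc)
  · intro S hS
    by_contra hnot
    obtain ⟨x, hx⟩ : ∃ x, x ∉ S := by
      by_contra! hall
      have := Finset.card_le_card fun v (_ : v ∈ Finset.univ) => hall v
      rw [Finset.card_univ] at this
      omega
    obtain ⟨A, B, h1, h2, h3, h4, h5, h6, h7⟩ :=
      SimpleGraph.exists_separation_of_not_connected_induce S hx hnot
    exact R.not_separation hR hconn
      (fun x y z => R.follows_or_follows_of_triangle hR hconn hV hc) S hS A B h1 h2 h3 h4 h5 h6 h7
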